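/- Let $\mathbb{F}$ be a finite field, $\mathbb{B}$ a subfield, $\ell=[\mathbb{F}:\mathbb{B}]$, $\mathrm{Tr}:\mathbb{F}\to\mathbb{B}$ the trace, $\mathcal{A}\subseteq\mathbb{F}$ a set of $n$ evaluation points, and $\mathcal{C}=\{(f(\alpha))_{\alpha\in\mathcal{A}} : f\in\mathbb{F}[x],\ \deg f<k\}$ the $[n,k]_{\mathbb{F}}$ Reed–Solomon code, $k\le n$; node $\alpha$ stores $f(\alpha)$. Put $\lambda_\alpha=\prod_{\gamma\in\mathcal{A}\setminus\{\alpha\}}(\alpha-\gamma)^{-1}$. A *canonical random linear repair scheme* for $\mathcal{C}$ over $\mathbb{B}$ consists of polynomials $P_{\beta,1},\dots,P_{\beta,\ell}\in\mathbb{F}[x]$ and a rational function $Q_\beta\in\mathbb{F}(x)$ without poles in $\mathcal{A}\setminus\{\beta\}$, for each $\beta\in\mathcal{A}$ (the node to be repaired), and of a random polynomial $R\in\mathbb{F}[x]$ whose law does not depend on $\beta$, such that for each value $R$ taken with positive probability the products $r_i=P_{\beta,i}Q_\beta R$ are parity-check polynomials, that is, polynomials of degree at most $n-k-1$. Each helper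 node $\alpha\in\mathcal{A}\setminus\{\beta\}$ receives the single query $Q_\beta(\alpha)R(\alpha)$ and sends back a fixed number $b_\alpha$ of sub-symbols in $\mathbb{B}$, which are $\mathbb{B}$-linear functions of $f(\alpha)$ that depend only on $\alpha$, on the query and on public information (not on $\beta$ or $R$), and from which the repair node, who knows $\beta$ and $R$, computes $\mathbb{B}$-linearly the terms $\mathrm{Tr}(\lambda_\alpha r_i(\alpha)f(\alpha))$, $1\le i\le\ell$, of the parity-check equations. These equations determine $f(\beta)$, that is, $r_1(\beta),\dots,r_\ell(\beta)$ are linearly independent over $\mathbb{B}$, whenever $R(\beta)\ne0$; and $R(\beta)\neq 0$ has positive probability for each $\beta\in\mathcal{A}$. The bandwidth of the scheme for the repair of $\beta$ is $b=\sum_{\alpha\in\mathcal{A}\setminus\{\beta\}}b_\alpha$. The scheme is *$t$-private* if, for $\beta$ uniformly distributed in $\mathcal{A}$ and independent of $R$, for every $J\subseteq\mathcal{A}$ with $|J|\le t$, conditionally on $\beta\notin J$ and on the queries received by the nodes of $J$, each $\beta^*\in\mathcal{A}\setminus J$ is the repaired node with probability $1/(n-|J|)$. **Theorem.** Let $1\le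 t<k$ and consider a $t$-private canonical random linear repair scheme for $\mathcal{C}$ over $\mathbb{B}$. If $t\ge2$, suppose that $Q_\beta$ depends on $\beta$ not merely through a scalar factor: there are $\beta,\beta'\in\mathcal{A}$ and $\alpha_1,\alpha_2\in\mathcal{A}\setminus\{\beta,\beta'\}$ with $Q_\beta(\alpha_1)Q_{\beta'}(\alpha_2)\ne Q_\beta(\alpha_2)Q_{\beta'}(\alpha_1)$. Then, for the repair of each $\beta\in\mathcal{A}$, the bandwidth satisfies $$b\ \ge\ b_{\min}=n_0\left\lfloor\log_{|\mathbb{B}|}\frac{n-1}{L}\right\rfloor+(n-1-n_0)\left\lceil\log_{|\mathbb{B}|}\frac{n-1}{L}\right\rceil,$$ where $$L=\frac{(|\mathbb{F}|-1)(n-k-t)+n-1}{|\mathbb{F}|},\qquad n_0=\left\lfloor\frac{L-(n-1)|\mathbb{B}|^{-\lceil\log_{|\mathbb{B}|}\frac{n-1}{L}\rceil}}{|\mathbb{B}|^{-\lfloor\log_{|\mathbb{B}|}\frac{n-1}{L}\rfloor}-|\mathbb{B}|^{-\lceil\log_{|\mathbb{B}|}\frac{n-1}{L}\rceil}}\right\rfloor,$$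 and $n_0=0$ if $\log_{|\mathbb{B}|}\frac{n-1}{L}$ is an integer (its value is then irrelevant). -/

import Mathlib

open Polynomial

noncomputable section

/-- A canonical random (linear) repair scheme over `B` for the Reed-Solomon code with set of
evaluation points `A ⊆ F` and dimension `k`. The nodes are the elements of `A`; the node `α` stores
`f(α)`, where `f` is a polynomial of degree less than `k`, and `β` is the node to be repaired.

Everything except `β` and the outcome of the random polynomial is public. -/
structure CanonicalRepairScheme (B : Type*) {F : Type*} [Field B] [Field F] [Algebra B F]
    [DecidableEq F] (A : Finset F) (k : ℕ) where
  /-- The polynomials `P_i`, which depend on `β` and on public information. -/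
  P : A → Fin (Module.finrank B F) → F[X]
  /-- The rational function `Q`, which depends on `β`. -/
  Q : A → RatFunc F
  /-- The law of the random polynomial `R`, drawn independently of `β`. -/
  law : PMF F[X]
  /-- The products `r_i = P_i Q R`. -/
  r : A → F[X] → Fin (Module.finrank B F) → F[X]
  /-- The number of sub-symbols that the node `α` sends. -/
  len : A → ℕ
  /-- `answer α q y` is what node `α` sends if it stores `y` and receives the query `q`. The node
  knows neither `β` nor `R`. -/
  answer : (α : A) → F → (F →ₗ[B] (Fin (len α) → B))
  /-- `Q` can be evaluated at all helper nodes. -/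
  Q_regular : ∀ β α : A, α ≠ β → (Q β).denom.eval (α : F) ≠ 0
  r_eq : ∀ β : A, ∀ R ∈ law.support, ∀ i,
    algebraMap F[X] (RatFunc F) (r β R i) =
      algebraMap F[X] (RatFunc F) (P β i) * Q β * algebraMap F[X] (RatFunc F) R
  /-- The `r_i` are parity-check polynomials: their degrees are at most `n - k - 1`, so that
  `(λ_α r_i(α))_α` is a word of the dual code, a generalized Reed-Solomon code of
  dimension `n - k`. -/
  r_degree : ∀ β : A, ∀ R ∈ law.support, ∀ i, (r β R i).degree < ((A.card - k : ℕ) : WithBot ℕ)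
  /-- From the answer of the helper node `α` to the query `Q(α) R(α)`, the repair node
  computes `B`-linearly the terms `Tr (λ_α r_i(α) f(α))` of the parity-check equations.
  Here `λ_α = ∏_{γ ≠ α} (α - γ)⁻¹`. -/
  answer_suffices : ∀ β : A, ∀ R ∈ law.support, ∀ α : A, α ≠ β → ∀ i,
    ∃ σ : Fin (len α) → B, ∀ y : F,
      Algebra.trace B F (Lagrange.nodalWeight A id (α : F) * (r β R i).eval (α : F) * y) =
        ∑ h, σ h * answer α (RatFunc.eval (RingHom.id F) (α : F) (Q β) * R.eval (α : F)) y h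
  /-- The parity-check equations determine `f(β)` unless `R(β) = 0`: the elements `r_i(β)` have
  `B`-rank `[F : B]`. -/
  correct : ∀ β : A, ∀ R ∈ law.support, R.eval (β : F) ≠ 0 →
    LinearIndependent B (fun i => (r β R i).eval (β : F))
  /-- Each node is repaired with positive probability. -/
  recoverable : ∀ β : A, ∃ R ∈ law.support, R.eval (β : F) ≠ 0

namespace CanonicalRepairScheme

variable {B F : Type*} [Field B] [Field F] [Algebra B F] [DecidableEq F] {A : Finset F} {k : ℕ}

/-- The query `Q(α) R(α)` that is sent to the helper node `α` when `β` is repaired. -/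
def query (S : CanonicalRepairScheme B A k) (β : A) (R : F[X]) (α : A) : F :=
  RatFunc.eval (RingHom.id F) (α : F) (S.Q β) * R.eval (α : F)

/-- The joint law of the repaired node `β`, uniform in `A`, and the independent random
polynomial `R`. -/
def joint [Nonempty A] (S : CanonicalRepairScheme B A k) : PMF (A × F[X]) :=
  (PMF.uniformOfFintype A).bind fun β => S.law.map (Prod.mk β)

/-- The event that no node of `J` is repaired and that the nodes of `J` receive the queries `κ`. -/
def queryEvent (S : CanonicalRepairScheme B A k) (J : Finset A) (κ : A → F) : Set (A × F[X]) :=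
  {ω | ω.1 ∉ J ∧ ∀ α ∈ J, S.query ω.1 ω.2 α = κ α}

/-- `t`-privacy: given the queries received by a set `J` of at most `t` helper nodes, each node
outside `J` is repaired with conditional probability `1 / (n - |J|)`. -/
def IsPrivate [Nonempty A] (S : CanonicalRepairScheme B A k) (t : ℕ) : Prop :=
  ∀ J : Finset A, J.card ≤ t → ∀ κ : A → F,
    S.joint.toOuterMeasure (S.queryEvent J κ) ≠ 0 → ∀ β : A, β ∉ J →
      S.joint.toOuterMeasure ({ω | ω.1 = β} ∩ S.queryEvent J κ) /
          S.joint.toOuterMeasure (S.queryEvent J κ) =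
        1 / ((A.card - J.card : ℕ) : ENNReal)

/-- `Q` involves `β`, and not merely through a scalar factor: for some `β, β'` the functions
`Q_β` and `Q_β'` are not proportional on the common helper nodes. -/
def QInvolvesIndex (S : CanonicalRepairScheme B A k) : Prop :=
  ∃ β β' α₁ α₂ : A, α₁ ≠ β ∧ α₁ ≠ β' ∧ α₂ ≠ β ∧ α₂ ≠ β' ∧
    RatFunc.eval (RingHom.id F) (α₁ : F) (S.Q β) * RatFunc.eval (RingHom.id F) (α₂ : F) (S.Q β') ≠
    RatFunc.eval (RingHom.id F) (α₂ : F) (S.Q β) * RatFunc.eval (RingHom.id F) (α₁ : F) (S.Q β')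

/-- The number of sub-symbols downloaded from the helper nodes when `β` is repaired. -/
def bandwidth (S : CanonicalRepairScheme B A k) (β : A) : ℕ :=
  ∑ α ∈ Finset.univ.erase β, S.len α

end CanonicalRepairScheme

/-- `L = ((|F| - 1)(n - k - t) + n - 1) / |F|`, where `cF = |F|`. -/
def boundL (cF n k t : ℕ) : ℝ :=
  (((cF : ℝ) - 1) * ((n : ℝ) - k - t) + ((n : ℝ) - 1)) / (cF : ℝ)

/-- `log_{|B|} ((n - 1) / L)`, where `cB = |B|`. -/
def boundLog (cB cF n k t : ℕ) : ℝ :=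
  Real.logb (cB : ℝ) (((n : ℝ) - 1) / boundL cF n k t)

/-- `n₀`. If the floor and the ceiling agree, the denominator is `0` and the value of `n₀` does
not affect `bMin`. -/
def boundN0 (cB cF n k t : ℕ) : ℤ :=
  ⌊(boundL cF n k t - ((n : ℝ) - 1) * (cB : ℝ) ^ (-⌈boundLog cB cF n k t⌉)) /
    ((cB : ℝ) ^ (-⌊boundLog cB cF n k t⌋) - (cB : ℝ) ^ (-⌈boundLog cB cF n k t⌉))⌋

/-- The lower bound on the bandwidth. -/
def bMin (cB cF n k t : ℕ) : ℤ :=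
  boundN0 cB cF n k t * ⌊boundLog cB cF n k t⌋ +
    ((n : ℤ) - 1 - boundN0 cB cF n k t) * ⌈boundLog cB cF n k t⌉

end

/-! The proof counts pairs of a coefficient vector `c` over `B` and a helper node `α` with `(P_c
Q_β)(α) = 0`, where `P_c = ∑ c_i P_i`. A node that sends few sub-symbols separates few vectors: at
least `|F| / |B| ^ len α` of them vanish there (`card_le_card_zeros_mul`). Conversely, each `c ≠ 0`
has at most `n - k - t` such zeros (`card_zeros_add_le`), so `∑ |B| ^ (-len α) ≤ L`, and convexity
turns this into the bound on `∑ len α`.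

For the bound on zeros, write `P_c Q_β = N / E` in lowest terms. Then `E` divides every `R = E T`,
and `deg N + deg T < n - k`. If some `T` has degree at least `t - 1`, this suffices. Otherwise the
`R` form too small a family for privacy: queries on `t` nodes look alike for `b` and `b'`, so
multiplication by `Q_b / Q_b'` preserves the span of the `R` restricted to these nodes. This forces
`Q_b / Q_b'` to be nearly constant, against `QInvolvesIndex` and `t < k`. -/

/-! ### Convexity: from a sum of negative powers to the bandwidth. -/

/-- The chord of the convex sequence `m ↦ p ^ (-m)` through two consecutive integers lies below
the sequence. -/
theorem chord_le_zpow_neg {p : ℝ} (hp : 1 < p) (a m : ℤ) :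
    p ^ (-a) - ((m : ℝ) - a) * (p ^ (-a) - p ^ (-(a + 1))) ≤ p ^ (-m) := by
  have hp0 : 0 < p := by linarith
  have ha : 0 < p ^ (-a) := zpow_pos hp0 _
  have hsucc : p ^ (-(a + 1)) = p ^ (-a) * p⁻¹ := by
    rw [neg_add, zpow_add₀ hp0.ne', zpow_neg_one]
  obtain ⟨d, rfl⟩ : ∃ d, m = a + d := ⟨m - a, by ring⟩
  have hm : p ^ (-(a + d)) = p ^ (-a) * p ^ (-d) := by
    rw [neg_add, zpow_add₀ hp0.ne']
  have hinv : p⁻¹ < 1 := inv_lt_one_of_one_lt₀ hp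
  have hinv0 : 0 < p⁻¹ := inv_pos.2 hp0
  suffices h : 1 - (d : ℝ) * (1 - p⁻¹) ≤ p ^ (-d) by
    rw [hsucc, hm]
    push_cast
    nlinarith
  -- Bernoulli's inequality, with base `p⁻¹` for `d ≥ 0` and base `p` for `d ≤ 0`; the latter slope
  -- suffices because `p + p⁻¹ ≥ 2`.
  obtain ⟨j, rfl | rfl⟩ := d.eq_nat_or_neg
  · have := one_add_mul_le_pow (a := p⁻¹ - 1) (by linarith) j
    rw [zpow_neg, zpow_natCast, ← inv_pow]
    push_cast
    rw [add_sub_cancel] at this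
    linarith
  · have := one_add_mul_le_pow (a := p - 1) (by linarith) j
    rw [neg_neg, zpow_natCast]
    push_cast
    rw [add_sub_cancel] at this
    have h2 : 1 - p⁻¹ ≤ p - 1 := by
      have : p * p⁻¹ = 1 := mul_inv_cancel₀ hp0.ne'
      nlinarith
    have h3 : (j : ℝ) * (1 - p⁻¹) ≤ j * (p - 1) := by gcongr
    linarith

/-- Natural numbers `len i` whose negative powers of `cB` have sum at most `L` have sum at least
`bMin`. -/
theorem bMin_le_sum {ι : Type*} (s : Finset ι) (len : ι → ℕ) {cB cF n k t : ℕ} (hB : 1 < cB)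
    (hn : s.card + 1 = n) (hs : 0 < s.card) (hL : 0 < boundL cF n k t)
    (h : ∑ i ∈ s, (cB : ℝ) ^ (-(len i : ℤ)) ≤ boundL cF n k t) :
    bMin cB cF n k t ≤ ((∑ i ∈ s, len i : ℕ) : ℤ) := by
  have hp : (1 : ℝ) < cB := by exact_mod_cast hB
  have hp0 : (0 : ℝ) < cB := by linarith
  have hnR : (n : ℝ) - 1 = s.card := by rw [← hn]; push_cast; ring
  have hnZ : (n : ℤ) - 1 = s.card := by rw [← hn]; push_cast; ring
  have hsR : (0 : ℝ) < s.card := by exact_mod_cast hs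
  have hchord : ∀ a : ℤ, (s.card : ℝ) * (cB : ℝ) ^ (-a) -
      ((∑ i ∈ s, len i : ℕ) - (s.card : ℝ) * a) * ((cB : ℝ) ^ (-a) - (cB : ℝ) ^ (-(a + 1)))
        ≤ boundL cF n k t := by
    intro a
    refine le_trans (le_of_eq ?_) (le_trans
      (Finset.sum_le_sum fun i _ => chord_le_zpow_neg hp a (len i)) h)
    rw [Finset.sum_sub_distrib, ← Finset.sum_mul, Finset.sum_sub_distrib]
    simp
  have hdelta : ∀ a : ℤ, 0 < (cB : ℝ) ^ (-a) - (cB : ℝ) ^ (-(a + 1)) := fun a =>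
    sub_pos.2 (zpow_lt_zpow_right₀ hp (by lia))
  have hx : (cB : ℝ) ^ (boundLog cB cF n k t) = s.card / boundL cF n k t := by
    rw [boundLog, hnR, Real.rpow_logb hp0 hp.ne' (by positivity)]
  unfold bMin
  rw [hnZ]
  set x := boundLog cB cF n k t with hxdef
  have hc := hchord ⌊x⌋
  have hd := hdelta ⌊x⌋
  by_cases hint : (⌊x⌋ : ℝ) = x
  · have hceil : ⌈x⌉ = ⌊x⌋ := by rw [← hint]; simp
    rw [hceil, ← add_mul, add_sub_cancel]
    rw [← hint, Real.rpow_intCast] at hx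
    have hLe : boundL cF n k t = s.card * (cB : ℝ) ^ (-⌊x⌋) := by
      rw [zpow_neg, hx]; field_simp
    rw [hLe] at hc
    have : (0 : ℝ) ≤ (∑ i ∈ s, len i : ℕ) - (s.card : ℝ) * ⌊x⌋ := by
      by_contra! hneg
      nlinarith
    have : (s.card : ℝ) * ⌊x⌋ ≤ (∑ i ∈ s, len i : ℕ) := by linarith
    exact_mod_cast this
  · have hceil : ⌈x⌉ = ⌊x⌋ + 1 := by
      refine (Int.ceil_eq_iff).2 ⟨?_, ?_⟩
      · push_cast
        have := lt_of_le_of_ne (Int.floor_le x) hint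
        linarith
      · push_cast
        exact (Int.lt_floor_add_one x).le
    unfold boundN0
    rw [← hxdef, hceil, hnR]
    set y := (boundL cF n k t - s.card * (cB : ℝ) ^ (-(⌊x⌋ + 1))) /
      ((cB : ℝ) ^ (-⌊x⌋) - (cB : ℝ) ^ (-(⌊x⌋ + 1))) with hy
    have hyd : y * ((cB : ℝ) ^ (-⌊x⌋) - (cB : ℝ) ^ (-(⌊x⌋ + 1))) =
        boundL cF n k t - s.card * (cB : ℝ) ^ (-(⌊x⌋ + 1)) := by
      rw [hy]; field_simp
    have hle : (s.card : ℝ) * (⌊x⌋ + 1) - (∑ i ∈ s, len i : ℕ) ≤ y := by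
      by_contra! hlt
      nlinarith
    -- The left side is an integer, so `y` may be rounded down to `n₀`; `bMin` is `s.card * (⌊x⌋ +
    -- 1) - n₀`.
    have hfl : (s.card : ℤ) * (⌊x⌋ + 1) - (∑ i ∈ s, len i : ℕ) ≤ ⌊y⌋ := by
      rw [Int.le_floor]; push_cast; push_cast at hle; exact hle
    linarith

/-! ### Consequences of privacy for the ratios `Q_b / Q_b'`. -/

namespace CanonicalRepairScheme

variable {B F : Type*} [Field B] [Field F] [Algebra B F] [DecidableEq F] {A : Finset F} {k t : ℕ}

theorem mem_support_joint [Nonempty A] (S : CanonicalRepairScheme B A k) (β : A) (R : F[X]) :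
    (β, R) ∈ S.joint.support ↔ R ∈ S.law.support := by
  simp [joint]

/-- Nodes that may only see few queries cannot exclude any node outside of them. -/
theorem IsPrivate.exists_query_eq [Nonempty A] {S : CanonicalRepairScheme B A k}
    (hS : S.IsPrivate t) {J : Finset A} (hJ : J.card ≤ t) {b b' : A} (hb : b ∉ J) (hb' : b' ∉ J)
    {R : F[X]} (hR : R ∈ S.law.support) :
    ∃ R' ∈ S.law.support, ∀ α ∈ J, S.query b' R' α = S.query b R α := by
  have hne : S.joint.toOuterMeasure (S.queryEvent J (S.query b R)) ≠ 0 := by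
    rw [Ne, PMF.toOuterMeasure_apply_eq_zero_iff, Set.not_disjoint_iff]
    exact ⟨(b, R), (S.mem_support_joint b R).2 hR, hb, fun _ _ => rfl⟩
  have h := hS J hJ (S.query b R) hne b' hb'
  have hnum : S.joint.toOuterMeasure ({ω | ω.1 = b'} ∩ S.queryEvent J (S.query b R)) ≠ 0 := by
    intro h0
    rw [h0, ENNReal.zero_div] at h
    exact (ENNReal.div_pos one_ne_zero (ENNReal.natCast_ne_top _)).ne h
  rw [Ne, PMF.toOuterMeasure_apply_eq_zero_iff, Set.not_disjoint_iff] at hnum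
  obtain ⟨⟨b₁, R'⟩, hsupp, rfl, -, hq⟩ := hnum
  exact ⟨R', (S.mem_support_joint _ _).1 hsupp, hq⟩

/-- The value of `Q_β` at the node `α`. -/
noncomputable def qval (S : CanonicalRepairScheme B A k) (β α : A) : F :=
  RatFunc.eval (RingHom.id F) (α : F) (S.Q β)

theorem query_eq (S : CanonicalRepairScheme B A k) (β : A) (R : F[X]) (α : A) :
    S.query β R α = S.qval β α * R.eval (α : F) := rfl

/-- If `Q_b'` vanishes at `α`, then under `b'` the node `α` only sees the query `0`, so a non-zero
query would rule out `b'`. -/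
theorem IsPrivate.qval_eq_zero [Nonempty A] {S : CanonicalRepairScheme B A k}
    (hS : S.IsPrivate t) (ht : 1 ≤ t) {b b' α : A} (hb : b ≠ α) (hb' : b' ≠ α)
    (h : S.qval b' α = 0) : S.qval b α = 0 := by
  obtain ⟨R, hR, hRα⟩ := S.recoverable α
  obtain ⟨R', -, hq⟩ := hS.exists_query_eq (J := {α}) (by simpa using ht) (b := b) (b' := b')
    (by simpa using hb) (by simpa using hb') hR
  have := hq α (by simp)
  rw [query_eq, query_eq, h, zero_mul] at this
  exact (mul_eq_zero.1 this.symm).resolve_right hRα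

/-- The span of the values of `R` contains a polynomial that vanishes at the nodes `C`, but not at
the node `α₁`, if `Q_b / Q_b'` takes other values at the nodes in `C` than at `α₁`. -/
theorem IsPrivate.exists_mem_span [Nonempty A] {S : CanonicalRepairScheme B A k}
    (hS : S.IsPrivate t) {b b' α₁ : A} {C : Finset A} (hC : C.card + 1 ≤ t)
    (hb : b ∉ insert α₁ C) (hb' : b' ∉ insert α₁ C)
    (hq : ∀ γ ∈ insert α₁ C, S.qval b' γ ≠ 0)
    (hu : ∀ γ ∈ C, S.qval b α₁ / S.qval b' α₁ ≠ S.qval b γ / S.qval b' γ) :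
    ∃ f ∈ Submodule.span F S.law.support, f.eval (α₁ : F) ≠ 0 ∧ ∀ γ ∈ C, f.eval (γ : F) = 0 := by
  have hJ : (insert α₁ C).card ≤ t := (Finset.card_insert_le _ _).trans hC
  -- On `insert α₁ C`, multiplication by `u = Q_b / Q_b'` preserves the restrictions of the span.
  have key : ∀ f ∈ Submodule.span F S.law.support, ∃ g ∈ Submodule.span F S.law.support,
      ∀ γ ∈ insert α₁ C, g.eval (γ : F) = S.qval b γ / S.qval b' γ * f.eval (γ : F) := by
    intro f hf
    induction hf using Submodule.span_induction with
    | mem R hR =>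
      obtain ⟨R', hR', h⟩ := hS.exists_query_eq hJ hb hb' hR
      refine ⟨R', Submodule.subset_span hR', fun γ hγ => ?_⟩
      have := h γ hγ
      rw [query_eq, query_eq] at this
      have h0 := hq γ hγ
      field_simp
      linear_combination this
    | zero => exact ⟨0, zero_mem _, by simp⟩
    | add f₁ f₂ _ _ h₁ h₂ =>
      obtain ⟨g₁, hg₁, h₁⟩ := h₁
      obtain ⟨g₂, hg₂, h₂⟩ := h₂
      refine ⟨g₁ + g₂, add_mem hg₁ hg₂, fun γ hγ => ?_⟩
      rw [eval_add, eval_add, h₁ γ hγ, h₂ γ hγ, mul_add]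
    | smul a f _ h =>
      obtain ⟨g, hg, h⟩ := h
      refine ⟨a • g, Submodule.smul_mem _ _ hg, fun γ hγ => ?_⟩
      rw [eval_smul, eval_smul, h γ hγ, smul_eq_mul, smul_eq_mul, mul_left_comm]
  -- Apply the factors `u - u(δ)`, `δ ∈ C`, successively to some `R` with `R(α₁) ≠ 0`: each kills
  -- the value at `δ` and keeps the one at `α₁` non-zero.
  suffices H : ∀ D ⊆ C, ∃ f ∈ Submodule.span F S.law.support,
      f.eval (α₁ : F) ≠ 0 ∧ ∀ γ ∈ D, f.eval (γ : F) = 0 from H C subset_rfl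
  intro D
  induction D using Finset.induction_on with
  | empty =>
    intro _
    obtain ⟨R, hR, h⟩ := S.recoverable α₁
    exact ⟨R, Submodule.subset_span hR, h, by simp⟩
  | insert δ D _ ih =>
    intro hD
    have hδ : δ ∈ C := hD (Finset.mem_insert_self _ _)
    obtain ⟨f, hf, hf₁, hf₀⟩ := ih ((Finset.subset_insert _ _).trans hD)
    obtain ⟨g, hg, h⟩ := key f hf
    refine ⟨g - (S.qval b δ / S.qval b' δ) • f, sub_mem hg (Submodule.smul_mem _ _ hf), ?_, ?_⟩
    · rw [eval_sub, eval_smul, h α₁ (Finset.mem_insert_self _ _), smul_eq_mul, ← sub_mul]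
      exact mul_ne_zero (sub_ne_zero.2 (hu δ hδ)) hf₁
    · intro γ hγ
      rw [eval_sub, eval_smul, h γ (Finset.mem_insert_of_mem (hD hγ)), smul_eq_mul, ← sub_mul]
      rcases Finset.mem_insert.1 hγ with rfl | hγ
      · rw [sub_self, zero_mul]
      · rw [hf₀ γ hγ, mul_zero]

/-- If `E` divides all values of `R`, has no zeros among the nodes, and `R / E` has degree at most
`d ≤ t - 2`, then `Q_b / Q_b'` differs from its value at `α₁` at no more than `d` nodes. -/
theorem IsPrivate.card_le_of_natDegree_le [Nonempty A] {S : CanonicalRepairScheme B A k}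
    (hS : S.IsPrivate t) {E : F[X]} (hE : ∀ R ∈ S.law.support, E ∣ R)
    (hE0 : ∀ α : A, E.eval (α : F) ≠ 0) {d : ℕ} (hd : d + 2 ≤ t)
    (hdeg : ∀ R ∈ S.law.support, R.natDegree ≤ E.natDegree + d) {b b' α₁ : A} {C : Finset A}
    (hb : b ∉ insert α₁ C) (hb' : b' ∉ insert α₁ C)
    (hq : ∀ γ ∈ insert α₁ C, S.qval b' γ ≠ 0)
    (hu : ∀ γ ∈ C, S.qval b α₁ / S.qval b' α₁ ≠ S.qval b γ / S.qval b' γ) :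
    C.card ≤ d := by
  by_contra! hlt
  -- With `d + 1` nodes in `D`, privacy still covers `insert α₁ D`, and `f / E` has more zeros than
  -- its degree `d` allows.
  obtain ⟨D, hDC, hD⟩ := Finset.exists_subset_card_eq (Nat.succ_le_of_lt hlt)
  have hins : insert α₁ D ⊆ insert α₁ C := Finset.insert_subset_insert _ hDC
  obtain ⟨f, hf, hf₁, hf₀⟩ := hS.exists_mem_span (C := D) (by lia) (fun h => hb (hins h))
    (fun h => hb' (hins h)) (fun γ h => hq γ (hins h)) (fun γ h => hu γ (hDC h))
  have hfE : E ∣ f := by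
    have : Submodule.span F S.law.support ≤ (Ideal.span {E}).restrictScalars F :=
      Submodule.span_le.2 fun R hR => Ideal.mem_span_singleton.2 (hE R hR)
    exact Ideal.mem_span_singleton.1 (this hf)
  have hfd : f.natDegree ≤ E.natDegree + d := by
    have : Submodule.span F S.law.support ≤ degreeLE F ((E.natDegree + d : ℕ) : WithBot ℕ) :=
      Submodule.span_le.2 fun R hR => mem_degreeLE.2 (natDegree_le_iff_degree_le.1 (hdeg R hR))
    exact natDegree_le_iff_degree_le.2 (mem_degreeLE.1 (this hf))
  obtain ⟨g, rfl⟩ := hfE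
  have hne : E * g ≠ 0 := by rintro h; simp [h] at hf₁
  have hg : g ≠ 0 := right_ne_zero_of_mul hne
  rw [natDegree_mul (left_ne_zero_of_mul hne) hg] at hfd
  have hcard : (D.map (Function.Embedding.subtype _)).card ≤ g.natDegree := by
    refine card_le_degree_of_subset_roots fun x hx => ?_
    obtain ⟨γ, hγ, rfl⟩ := Finset.mem_map.1 hx
    rw [mem_roots hg, IsRoot.def]
    have := hf₀ γ hγ
    rw [eval_mul] at this
    exact (mul_eq_zero.1 this).resolve_left (hE0 γ)
  rw [Finset.card_map] at hcard
  lia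

/-- If `R / E` always has small degree `d`, then there are few nodes to which non-zero queries
can be sent. -/
theorem IsPrivate.card_add_le [Nonempty A] {S : CanonicalRepairScheme B A k}
    (hS : S.IsPrivate t) (hQ : S.QInvolvesIndex) {E : F[X]} (hE : ∀ R ∈ S.law.support, E ∣ R)
    (hE0 : ∀ α : A, E.eval (α : F) ≠ 0) {d : ℕ} (hd : d + 2 ≤ t)
    (hdeg : ∀ R ∈ S.law.support, R.natDegree ≤ E.natDegree + d) (β : A) :
    A.card ≤ 2 * d + 3 + (Finset.univ.filter fun α => α ≠ β ∧ S.qval β α = 0).card := by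
  have ht : 1 ≤ t := by lia
  obtain ⟨b, b', α₁, α₂, h1b, h1b', h2b, h2b', hne⟩ := hQ
  change S.qval b α₁ * S.qval b' α₂ ≠ S.qval b α₂ * S.qval b' α₁ at hne
  have hzero : ∀ {α : A}, b ≠ α → b' ≠ α → S.qval b' α = 0 → S.qval b α = 0 :=
    fun h h' h0 => hS.qval_eq_zero ht h h' h0
  have hq₁ : S.qval b' α₁ ≠ 0 := fun h => hne (by rw [h, hzero h1b.symm h1b'.symm h]; ring)
  have hq₂ : S.qval b' α₂ ≠ 0 := fun h => hne (by rw [h, hzero h2b.symm h2b'.symm h]; ring)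
  have hne' : S.qval b α₁ / S.qval b' α₁ ≠ S.qval b α₂ / S.qval b' α₂ := by
    rwa [Ne, div_eq_div_iff hq₁ hq₂]
  set C : A → Finset A := fun α₀ => Finset.univ.filter fun γ => γ ≠ b ∧ γ ≠ b' ∧
    S.qval b' γ ≠ 0 ∧ S.qval b α₀ / S.qval b' α₀ ≠ S.qval b γ / S.qval b' γ with hCdef
  have hC : ∀ α₀ : A, α₀ ≠ b → α₀ ≠ b' → S.qval b' α₀ ≠ 0 → (C α₀).card ≤ d := by
    intro α₀ h h' h0
    refine hS.card_le_of_natDegree_le hE hE0 hd hdeg (b := b) (b' := b') (α₁ := α₀) ?_ ?_ ?_ ?_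
    · simp [hCdef, h.symm]
    · simp [hCdef, h'.symm]
    · intro γ hγ
      rcases Finset.mem_insert.1 hγ with rfl | hγ
      · exact h0
      · exact (Finset.mem_filter.1 hγ).2.2.2.1
    · exact fun γ hγ => (Finset.mem_filter.1 hγ).2.2.2.2
  -- Outside `b`, `b'`, `β` and the zeros of `Q_β`, the ratio at `γ` cannot equal both of its
  -- distinct values at `α₁` and `α₂`.
  have hcover : (Finset.univ : Finset A) ⊆ ((C α₁ ∪ C α₂) ∪ {b, b', β}) ∪
      Finset.univ.filter fun α => α ≠ β ∧ S.qval β α = 0 := by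
    intro γ _
    by_contra hγ
    simp only [hCdef, Finset.mem_union, Finset.mem_filter, Finset.mem_univ, true_and,
      Finset.mem_insert, Finset.mem_singleton, not_or, not_and] at hγ
    obtain ⟨⟨⟨h1, h2⟩, hb, hb', hβ⟩, hz⟩ := hγ
    have h0 : S.qval b' γ ≠ 0 := fun h =>
      hz hβ (hS.qval_eq_zero ht (Ne.symm hβ) (Ne.symm hb') h)
    exact hne' ((not_not.1 (h1 hb hb' h0)).trans (not_not.1 (h2 hb hb' h0)).symm)
  have hcard := (Finset.card_le_card hcover).trans (Finset.card_union_le _ _)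
  have h1 := Finset.card_union_le (C α₁ ∪ C α₂) {b, b', β}
  have h2 := Finset.card_union_le (C α₁) (C α₂)
  have h3 : ({b, b', β} : Finset A).card ≤ 3 := Finset.card_le_three
  have h4 := hC α₁ h1b h1b' hq₁
  have h5 := hC α₂ h2b h2b' hq₂
  rw [Finset.card_univ, Fintype.card_coe] at hcard
  lia

end CanonicalRepairScheme

theorem RatFunc.mul_algebraMap_denom {F : Type*} [Field F] (x : RatFunc F) :
    x * algebraMap F[X] (RatFunc F) x.denom = algebraMap F[X] (RatFunc F) x.num := by
  have h : algebraMap F[X] (RatFunc F) x.denom ≠ 0 := by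
    rw [Ne, map_eq_zero_iff _ (IsFractionRing.injective F[X] (RatFunc F))]
    exact x.denom_ne_zero
  exact (eq_div_iff h).1 x.num_div_denom.symm

/-! ### Zeros of the combinations `P_c Q_β` and double counting. -/

namespace CanonicalRepairScheme

variable {B F : Type*} [Field B] [Field F] [Algebra B F] [DecidableEq F] {A : Finset F} {k t : ℕ}

/-- The combination of the polynomials `P_i` with coefficients `c` in `B`. -/
noncomputable def combP (S : CanonicalRepairScheme B A k) (β : A)
    (c : Fin (Module.finrank B F) → B) : F[X] :=
  ∑ i, C (algebraMap B F (c i)) * S.P β i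

/-- The combination of the parity-check polynomials `r_i` with coefficients `c` in `B`. -/
noncomputable def combR (S : CanonicalRepairScheme B A k) (β : A) (R : F[X])
    (c : Fin (Module.finrank B F) → B) : F[X] :=
  ∑ i, C (algebraMap B F (c i)) * S.r β R i

theorem algebraMap_combR (S : CanonicalRepairScheme B A k) (β : A) {R : F[X]}
    (hR : R ∈ S.law.support) (c : Fin (Module.finrank B F) → B) :
    algebraMap F[X] (RatFunc F) (S.combR β R c) =
      algebraMap F[X] (RatFunc F) (S.combP β c) * S.Q β * algebraMap F[X] (RatFunc F) R := by
  simp only [combR, combP, map_sum, map_mul, S.r_eq β R hR, Finset.sum_mul, mul_assoc]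

theorem degree_combR (S : CanonicalRepairScheme B A k) (β : A) {R : F[X]}
    (hR : R ∈ S.law.support) (c : Fin (Module.finrank B F) → B) :
    (S.combR β R c).degree < ((A.card - k : ℕ) : WithBot ℕ) := by
  rw [← mem_degreeLT, combR]
  refine sum_mem fun i _ => ?_
  rw [← smul_eq_C_mul]
  exact Submodule.smul_mem _ _ (mem_degreeLT.2 (S.r_degree β R hR i))

theorem combR_eval_ne_zero (S : CanonicalRepairScheme B A k) (β : A) {R : F[X]}
    (hR : R ∈ S.law.support) (hβ : R.eval (β : F) ≠ 0) {c : Fin (Module.finrank B F) → B}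
    (hc : c ≠ 0) : (S.combR β R c).eval (β : F) ≠ 0 := by
  intro h
  refine hc (funext (Fintype.linearIndependent_iff.1 (S.correct β R hR hβ) c ?_))
  simpa [combR, eval_finsetSum, Algebra.smul_def] using h

/-- The function `P_c Q_β` is a quotient `N / E` whose denominator divides all values of `R`. -/
theorem exists_num_denom (S : CanonicalRepairScheme B A k) (β : A)
    {c : Fin (Module.finrank B F) → B} (hc : c ≠ 0) :
    ∃ N E : F[X], N ≠ 0 ∧ E ≠ 0 ∧ (∀ R ∈ S.law.support, E ∣ R) ∧
      (∀ α : A, E.eval (α : F) ≠ 0) ∧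
      (∀ T : F[X], E * T ∈ S.law.support → S.combR β (E * T) c = N * T) ∧
      ∀ α : A, α ≠ β → (S.combP β c).eval (α : F) * S.qval β α = 0 → N.eval (α : F) = 0 := by
  set G := algebraMap F[X] (RatFunc F) (S.combP β c) * S.Q β with hG
  have hE : G.denom ≠ 0 := G.denom_ne_zero
  have hinj := IsFractionRing.injective F[X] (RatFunc F)
  have hGE : G * algebraMap F[X] (RatFunc F) G.denom = algebraMap F[X] (RatFunc F) G.num :=
    G.mul_algebraMap_denom
  have hmul : ∀ R ∈ S.law.support, S.combR β R c * G.denom = G.num * R := by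
    intro R hR
    apply hinj
    rw [map_mul, map_mul, S.algebraMap_combR β hR, ← hG, ← hGE]
    ring
  have hdvd : ∀ R ∈ S.law.support, G.denom ∣ R := fun R hR =>
    (G.isCoprime_num_denom.symm).dvd_of_dvd_mul_left ⟨S.combR β R c, by
      rw [← hmul R hR, mul_comm]⟩
  refine ⟨G.num, G.denom, ?_, hE, hdvd, ?_, ?_, ?_⟩
  · intro h
    obtain ⟨R, hR, hβ⟩ := S.recoverable β
    have := hmul R hR
    rw [h, zero_mul] at this
    refine S.combR_eval_ne_zero β hR hβ hc ?_
    rw [(mul_eq_zero.1 this).resolve_right hE, eval_zero]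
  -- A zero of `E` at `α` would be a zero of every `R`, and `α` could never be repaired.
  · intro α h
    obtain ⟨R, hR, hα⟩ := S.recoverable α
    obtain ⟨T, rfl⟩ := hdvd R hR
    exact hα (by rw [eval_mul, h, zero_mul])
  · intro T hT
    have := hmul _ hT
    refine mul_right_cancel₀ hE ?_
    rw [this]
    ring
  · intro α hα h
    have hd := S.Q_regular β α hα
    have hnum : (S.combP β c).eval (α : F) * (S.Q β).num.eval (α : F) = 0 := by
      rw [qval, RatFunc.eval, eval₂_id, eval₂_id, ← mul_div_assoc, div_eq_zero_iff] at h
      exact h.resolve_right hd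
    have hpoly : G.num * (S.Q β).denom = S.combP β c * (S.Q β).num * G.denom := by
      apply hinj
      rw [map_mul, map_mul, map_mul, ← hGE, ← (S.Q β).mul_algebraMap_denom, hG]
      ring
    have := congrArg (eval (α : F)) hpoly
    rw [eval_mul, eval_mul, eval_mul, hnum, zero_mul] at this
    exact (mul_eq_zero.1 this).resolve_right hd

/-- A non-zero combination of the `P_i Q_β` has at most `n - k - t` zeros among the helper
nodes. -/
theorem IsPrivate.card_zeros_add_le [Nonempty A] {S : CanonicalRepairScheme B A k}
    (hS : S.IsPrivate t) (htk : t < k) (hQ : 2 ≤ t → S.QInvolvesIndex) (β : A)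
    {c : Fin (Module.finrank B F) → B} (hc : c ≠ 0) :
    (Finset.univ.filter fun α : A =>
      α ≠ β ∧ (S.combP β c).eval (α : F) * S.qval β α = 0).card + k + t ≤ A.card := by
  obtain ⟨N, E, hN, hE, hdvd, hE0, hcomb, hz⟩ := S.exists_num_denom β hc
  have hcard : (Finset.univ.filter fun α : A =>
      α ≠ β ∧ (S.combP β c).eval (α : F) * S.qval β α = 0).card ≤ N.natDegree := by
    rw [← Finset.card_map (Function.Embedding.subtype _)]
    refine card_le_degree_of_subset_roots fun x hx => ?_
    obtain ⟨γ, hγ, rfl⟩ := Finset.mem_map.1 hx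
    rw [mem_roots hN, IsRoot.def]
    exact hz γ (Finset.mem_filter.1 hγ).2.1 (Finset.mem_filter.1 hγ).2.2
  have hdeg : ∀ T : F[X], T ≠ 0 → E * T ∈ S.law.support →
      N.natDegree + T.natDegree + k < A.card := by
    intro T hT hs
    have := S.degree_combR β hs c
    rw [hcomb T hs, degree_eq_natDegree (mul_ne_zero hN hT), natDegree_mul hN hT,
      Nat.cast_lt] at this
    lia
  -- `T₀` is a cofactor `R / E` of maximal degree; degrees are bounded since `N T` is a parity-check
  -- polynomial.
  obtain ⟨T₀, hT₀, hs₀, hmax⟩ : ∃ T₀ : F[X], T₀ ≠ 0 ∧ E * T₀ ∈ S.law.support ∧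
      ∀ T : F[X], T ≠ 0 → E * T ∈ S.law.support → T.natDegree ≤ T₀.natDegree := by
    set D : Set ℕ := natDegree '' {T : F[X] | T ≠ 0 ∧ E * T ∈ S.law.support} with hD
    have hbdd : BddAbove D := by
      refine ⟨A.card, ?_⟩
      rintro _ ⟨T, ⟨hT, hs⟩, rfl⟩
      have := hdeg T hT hs
      lia
    have hne : D.Nonempty := by
      obtain ⟨R, hR, hRβ⟩ := S.recoverable β
      obtain ⟨T, rfl⟩ := hdvd R hR
      exact ⟨_, T, ⟨by rintro rfl; simp at hRβ, hR⟩, rfl⟩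
    obtain ⟨T₀, ⟨hT₀, hs₀⟩, h⟩ := Nat.sSup_mem hne hbdd
    exact ⟨T₀, hT₀, hs₀, fun T hT hs => h ▸ le_csSup hbdd ⟨T, ⟨hT, hs⟩, rfl⟩⟩
  have h₀ := hdeg T₀ hT₀ hs₀
  by_cases hd : T₀.natDegree + 2 ≤ t
  · have hle := hS.card_add_le (hQ (by lia)) hdvd hE0 hd (fun R hR => by
      obtain ⟨T, rfl⟩ := hdvd R hR
      rcases eq_or_ne T 0 with rfl | hT
      · simp
      · rw [natDegree_mul hE hT]
        exact Nat.add_le_add_left (hmax T hT hR) _) β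
    have hsub : (Finset.univ.filter fun α : A => α ≠ β ∧ S.qval β α = 0).card ≤
        (Finset.univ.filter fun α : A =>
          α ≠ β ∧ (S.combP β c).eval (α : F) * S.qval β α = 0).card :=
      Finset.card_le_card fun α hα => by
        rw [Finset.mem_filter] at hα ⊢
        exact ⟨hα.1, hα.2.1, by rw [hα.2.2, mul_zero]⟩
    -- With `d = deg T₀`, the number of zeros is at most `n - k - d - 1` and at least `n - 2d - 3`;
    -- hence `k ≤ d + 2 ≤ t`, a contradiction.
    lia
  · lia

/-- Many combinations of the `P_i Q_β` vanish at a helper node that sends few sub-symbols. -/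
theorem card_le_card_zeros_mul [Finite F] [Fintype (Fin (Module.finrank B F) → B)]
    (S : CanonicalRepairScheme B A k) {β α : A} (hα : α ≠ β) :
    Nat.card F ≤ (Finset.univ.filter fun c : Fin (Module.finrank B F) → B =>
      (S.combP β c).eval (α : F) * S.qval β α = 0).card * Nat.card B ^ S.len α := by
  have : Finite B := Finite.of_injective _ (algebraMap B F).injective
  obtain ⟨R, hR, hRα⟩ := S.recoverable α
  choose σ hσ using S.answer_suffices β R hR α hα
  -- `φ c` expresses the trace term of `r_c = ∑ c_i r_i` through the answer of `α`. On its kernel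
  -- `Tr (λ_α r_c(α) y) = 0` for all `y`, so `r_c(α) = 0`; the kernel has dimension at least `[F :
  -- B] - len α`.
  let φ : (Fin (Module.finrank B F) → B) →ₗ[B] (Fin (S.len α) → B) := Fintype.linearCombination B σ
  have hker : ∀ c ∈ LinearMap.ker φ, (S.combP β c).eval (α : F) * S.qval β α = 0 := by
    intro c hc
    have hc' : ∀ h, ∑ i, c i * σ i h = 0 := fun h => by
      have := congrFun (LinearMap.mem_ker.1 hc) h
      simpa [φ, Fintype.linearCombination_apply, Finset.sum_apply] using this
    have hr : (S.combR β R c).eval (α : F) = 0 := by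
      have htr : ∀ y, Algebra.traceForm B F
          (Lagrange.nodalWeight A id (α : F) * (S.combR β R c).eval (α : F)) y = 0 := by
        intro y
        have : Lagrange.nodalWeight A id (α : F) * (S.combR β R c).eval (α : F) * y =
            ∑ i, c i • (Lagrange.nodalWeight A id (α : F) * (S.r β R i).eval (α : F) * y) := by
          simp only [combR, eval_finsetSum, eval_mul, eval_C, Finset.mul_sum, Finset.sum_mul,
            Algebra.smul_def]
          exact Finset.sum_congr rfl fun i _ => by ring
        rw [Algebra.traceForm_apply, this, map_sum]
        simp only [map_smul, hσ, smul_eq_mul, Finset.mul_sum]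
        rw [Finset.sum_comm]
        simp only [← mul_assoc, ← Finset.sum_mul, hc', zero_mul, Finset.sum_const_zero]
      have h0 := (traceForm_nondegenerate B F).1 _ htr
      exact (mul_eq_zero.1 h0).resolve_left
        (Lagrange.nodalWeight_ne_zero (Function.injective_id.injOn) α.2)
    have hmul : (S.combR β R c).eval (α : F) =
        (S.combP β c).eval (α : F) * S.qval β α * R.eval (α : F) := by
      have hd := S.Q_regular β α hα
      have hinj := IsFractionRing.injective F[X] (RatFunc F)
      have hpoly : S.combR β R c * (S.Q β).denom = S.combP β c * (S.Q β).num * R := by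
        apply hinj
        rw [map_mul, map_mul, map_mul, ← (S.Q β).mul_algebraMap_denom, S.algebraMap_combR β hR]
        ring
      have h := congrArg (eval (α : F)) hpoly
      rw [eval_mul, eval_mul, eval_mul] at h
      rw [qval, RatFunc.eval, eval₂_id, eval₂_id]
      field_simp
      exact h
    rw [hmul] at hr
    exact (mul_eq_zero.1 hr).resolve_right hRα
  have hcard : Nat.card (LinearMap.ker φ) ≤ (Finset.univ.filter fun c =>
      (S.combP β c).eval (α : F) * S.qval β α = 0).card := by
    rw [← Nat.card_eq_finsetCard]
    exact Nat.card_le_card_of_injective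
      (fun c : LinearMap.ker φ => ⟨c.1, Finset.mem_filter.2 ⟨Finset.mem_univ _, hker c.1 c.2⟩⟩)
      fun c c' h => Subtype.ext (Subtype.mk.inj h)
  refine le_trans ?_ (Nat.mul_le_mul_right _ hcard)
  have hrank := φ.finrank_range_add_finrank_ker
  rw [Module.finrank_fintype_fun_eq_card, Fintype.card_fin] at hrank
  have hrange : Module.finrank B (LinearMap.range φ) ≤ S.len α := by
    simpa using (LinearMap.range φ).finrank_le
  rw [Module.natCard_eq_pow_finrank (K := B) (V := F),
    Module.natCard_eq_pow_finrank (K := B) (V := LinearMap.ker φ), ← pow_add]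
  exact Nat.pow_le_pow_right Nat.card_pos (by lia)

/-- The trade-off between the numbers of sub-symbols sent by the helper nodes. -/
theorem IsPrivate.sum_zpow_neg_len_le [Finite F] [Nonempty A] {S : CanonicalRepairScheme B A k}
    (hS : S.IsPrivate t) (htk : t < k) (hQ : 2 ≤ t → S.QInvolvesIndex) (β : A) :
    ∑ α ∈ Finset.univ.erase β, (Nat.card B : ℝ) ^ (-(S.len α : ℤ)) ≤
      boundL (Nat.card F) A.card k t := by
  classical
  have : Finite B := Finite.of_injective _ (algebraMap B F).injective
  have := Fintype.ofFinite B
  have hq : (0 : ℝ) < Nat.card F := by exact_mod_cast Nat.card_pos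
  have hp : (0 : ℝ) < Nat.card B := by exact_mod_cast Nat.card_pos
  let z : A → (Fin (Module.finrank B F) → B) → Prop := fun α c =>
    (S.combP β c).eval (α : F) * S.qval β α = 0
  have hcardB : (Finset.univ : Finset (Fin (Module.finrank B F) → B)).card = Nat.card F := by
    rw [Module.natCard_eq_pow_finrank (K := B) (V := F)]
    simp
  have hz0 : ∀ α, z α 0 := fun α => by simp [z, combP]
  have hcol : ∀ c ∈ Finset.univ.erase (0 : Fin (Module.finrank B F) → B),
      (((Finset.univ.erase β).filter fun α => z α c).card : ℝ) ≤ A.card - k - t := by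
    intro c hc
    have := hS.card_zeros_add_le htk hQ β (Finset.ne_of_mem_erase hc)
    have heq : (Finset.univ.erase β).filter (fun α => z α c) = Finset.univ.filter fun α : A =>
        α ≠ β ∧ (S.combP β c).eval (α : F) * S.qval β α = 0 := by
      ext α; simp [z]
    rw [heq]
    have h : (((Finset.univ.filter fun α : A => α ≠ β ∧
      (S.combP β c).eval (α : F) * S.qval β α = 0).card + k + t : ℕ) : ℝ) ≤ A.card := by
      exact_mod_cast this
    push_cast at h
    linarith
  have hzero : (Finset.univ.erase β).filter (fun α => z α 0) = Finset.univ.erase β :=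
    Finset.filter_true_of_mem fun α _ => hz0 α
  have hApos : 0 < A.card := Finset.card_pos.2 ⟨β, β.2⟩
  have hAcard : ((Finset.univ.erase β : Finset A).card : ℝ) = A.card - 1 := by
    rw [Finset.card_erase_of_mem (Finset.mem_univ _), Finset.card_univ, Fintype.card_coe,
      Nat.cast_sub hApos, Nat.cast_one]
  -- The vector `c = 0` contributes all `n - 1` helper nodes, each other `c` at most `n - k - t`.
  have hdouble : ∑ α ∈ Finset.univ.erase β, ((Finset.univ.filter (z α)).card : ℝ) =
      ∑ c, (((Finset.univ.erase β).filter fun α => z α c).card : ℝ) := by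
    exact_mod_cast Finset.sum_card_bipartiteAbove_eq_sum_card_bipartiteBelow z
  have hsum : ∑ α ∈ Finset.univ.erase β, ((Finset.univ.filter (z α)).card : ℝ) ≤
      ((Nat.card F : ℝ) - 1) * ((A.card : ℝ) - k - t) + ((A.card : ℝ) - 1) := by
    rw [hdouble, ← Finset.sum_erase_add _ _ (Finset.mem_univ 0), hzero, hAcard]
    refine add_le_add_left ((Finset.sum_le_card_nsmul _ _ _ hcol).trans_eq ?_) _
    rw [Finset.card_erase_of_mem (Finset.mem_univ _), hcardB, nsmul_eq_mul,
      Nat.cast_sub Nat.card_pos, Nat.cast_one]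
  rw [boundL, le_div_iff₀ hq, Finset.sum_mul]
  refine (Finset.sum_le_sum fun α hα => ?_).trans hsum
  have h : (Nat.card F : ℝ) ≤ (Finset.univ.filter (z α)).card * (Nat.card B : ℝ) ^ S.len α := by
    exact_mod_cast S.card_le_card_zeros_mul (Finset.ne_of_mem_erase hα)
  rw [zpow_neg, zpow_natCast, inv_mul_le_iff₀ (by positivity), mul_comm]
  exact h

end CanonicalRepairScheme

theorem theorem3 {B F : Type*} [Field B] [Field F] [Algebra B F] [Finite F] [DecidableEq F]
    (A : Finset F) [Nonempty A] (k t : ℕ) (hk : k ≤ A.card) (ht : 1 ≤ t) (htk : t < k)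
    (S : CanonicalRepairScheme B A k) (hQ : 2 ≤ t → S.QInvolvesIndex) (hS : S.IsPrivate t)
    (β : A) :
    bMin (Nat.card B) (Nat.card F) A.card k t ≤ (S.bandwidth β : ℤ) := by
  have : Finite B := Finite.of_injective _ (algebraMap B F).injective
  have hcard : (Finset.univ.erase β : Finset A).card + 1 = A.card := by
    rw [Finset.card_erase_add_one (Finset.mem_univ _), Finset.card_univ, Fintype.card_coe]
  have hsum := hS.sum_zpow_neg_len_le htk hQ β
  -- `1 ≤ t < k ≤ n` gives a helper node, and `L > 0` because it bounds a non-empty sum of positive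
  -- powers.
  have hpos : 0 < (Finset.univ.erase β : Finset A).card := by lia
  refine bMin_le_sum _ S.len Finite.one_lt_card hcard hpos (lt_of_lt_of_le ?_ hsum) hsum
  exact Finset.sum_pos (fun α _ => zpow_pos (by exact_mod_cast Nat.card_pos) _)
    (Finset.card_pos.1 hpos)
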